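/- Let $n\ge 0$ be an integer, let $X=(X_1,\dots,X_n)$ be uniformly distributed on $\{0,1\}^n$ (independent fair bits on some probability space), let $f:\{0,1\}^n\to\mathbb{R}$ and let $v>0$ be such that $$\sum_{i=1}^n \big(f(x)-f(x^{(i)})\big)_+^2\le v\qquad\text{for all }x\in\{0,1\}^n,$$ where $x^{(i)}$ is $x$ with its $i$-th bit flipped and $a_+=\max(a,0)$. For $\alpha\in(0,1)$ let $Q_\alpha=\inf\{z\in\mathbb{R}:\mathbf{P}\{f(X)\le z\}\ge\alpha\}$ be the $\alpha$-quantile of $f(X)$. Then for all $0<\delta<\gamma\le 1/2$, $$Q_{1-\delta}-Q_{1-\gamma}\le\sqrt{\frac{(72/5)\,v\,\gamma}{\delta\,\log\big(e^2/(2\gamma)\big)}}.$$ In particular, with $a_k=Q_{1-2^{-k}}$, the quantile sequence is locally sub-Gaussian in the following sense: for every integer $k\ge 1$, both $$a_{k+1}-a_k\le\frac{12}{\sqrt5}\sqrt{\frac{v}{(k-1)\log 2+2}}\qquad\text{and}\qquad a_{k+1}-a_k\le 4\sqrt{\frac{v}{k}}.$$ -/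

import Mathlib

open MeasureTheory ProbabilityTheory

/-- The point `x^{(i)}` of the binary cube obtained from `x` by flipping the `i`-th bit. -/
def flipBit {n : ℕ} (x : Fin n → Bool) (i : Fin n) : Fin n → Bool :=
  Function.update x i (!x i)

/-- The condition `∑ i, (f(x) - f(x^{(i)}))_+ ^ 2 ≤ v` for all `x` in the
binary cube, where `a_+ = max a 0`. -/
def BoundedSquaredDrops {n : ℕ} (f : (Fin n → Bool) → ℝ) (v : ℝ) : Prop :=
  ∀ x : Fin n → Bool, ∑ i : Fin n, (max (f x - f (flipBit x i)) 0) ^ 2 ≤ v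

/-- The random bits `X 1, …, X n` are independent and each of them is a fair coin, that is,
the random vector `(X 1, …, X n)` is uniformly distributed on the binary cube. -/
structure IsFairBits {n : ℕ} {Ω : Type*} [MeasurableSpace Ω] (P : Measure Ω)
    (X : Fin n → Ω → Bool) : Prop where
  measurable : ∀ i, Measurable (X i)
  indep : iIndepFun X P
  fair : ∀ i, P.real {ω | X i ω = true} = 1 / 2

/-- The `α`-quantile `Q_α = inf {z : P{Y ≤ z} ≥ α}` of a real random variable `Y`
(used for `0 < α < 1`, where the set is nonempty and bounded below). -/
noncomputable def quantile {Ω : Type*} [MeasurableSpace Ω] (P : Measure Ω) (Y : Ω → ℝ)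
    (α : ℝ) : ℝ :=
  sInf {z : ℝ | α ≤ P.real {ω | Y ω ≤ z}}

/-! Let `q < r` be the two quantiles and `g = max q (min f r)`. Since `g` equals `q` on mass at
least `1/2` and `r` on mass at least `δ`, its variance is at least `δ (r - q)² / 2`. Truncation does
not enlarge drops, and `g` has none outside `{f > q}`, a set of mass at most `γ`. Hence its
Dirichlet form is at most `v γ / 2`, and by Cauchy-Schwarz its squared `L¹`-influences sum to at
most `v γ²`.

The Poincaré inequality would miss the logarithm. It comes from `cubeVar_mul_log_le`, where the free
parameter `l`, taken of order `1 / γ`, balances the two bounds. That inequality applies the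
logarithmic Sobolev inequality to the half-difference in each successive bit, with entropy bounded
below through `L¹` and `L²` norms in `le_entropy_sq`. -/

/-- The average of a function over the binary cube. -/
noncomputable def cubeAvg {n : ℕ} (g : (Fin n → Bool) → ℝ) : ℝ := (∑ x, g x) / 2 ^ n

theorem cubeAvg_add {n : ℕ} (g h : (Fin n → Bool) → ℝ) :
    cubeAvg (fun x => g x + h x) = cubeAvg g + cubeAvg h := by
  simp only [cubeAvg, Finset.sum_add_distrib, add_div]

theorem cubeAvg_const_mul {n : ℕ} (c : ℝ) (g : (Fin n → Bool) → ℝ) :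
    cubeAvg (fun x => c * g x) = c * cubeAvg g := by
  simp only [cubeAvg, ← Finset.mul_sum, mul_div_assoc]

theorem cubeAvg_sub {n : ℕ} (g h : (Fin n → Bool) → ℝ) :
    cubeAvg (fun x => g x - h x) = cubeAvg g - cubeAvg h := by
  simp only [cubeAvg, Finset.sum_sub_distrib, sub_div]

theorem cubeAvg_sum {n : ℕ} {ι : Type*} (s : Finset ι) (g : ι → (Fin n → Bool) → ℝ) :
    cubeAvg (fun x => ∑ i ∈ s, g i x) = ∑ i ∈ s, cubeAvg (g i) := by
  simp only [cubeAvg, Finset.sum_comm (s := Finset.univ) (t := s), Finset.sum_div]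

theorem cubeAvg_const {n : ℕ} (c : ℝ) : cubeAvg (fun _ : Fin n → Bool => c) = c := by
  simp [cubeAvg]

theorem cubeAvg_mono {n : ℕ} {g h : (Fin n → Bool) → ℝ} (H : ∀ x, g x ≤ h x) :
    cubeAvg g ≤ cubeAvg h := by
  unfold cubeAvg
  gcongr
  exact H _

theorem cubeAvg_nonneg {n : ℕ} {g : (Fin n → Bool) → ℝ} (H : ∀ x, 0 ≤ g x) :
    0 ≤ cubeAvg g :=
  div_nonneg (Finset.sum_nonneg fun x _ => H x) (by positivity)

theorem cubeAvg_zero (g : (Fin 0 → Bool) → ℝ) : cubeAvg g = g default := by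
  simp only [cubeAvg, Fintype.sum_unique, pow_zero, div_one]
  exact congrArg g (Subsingleton.elim _ _)

theorem cubeAvg_succ {n : ℕ} (g : (Fin (n + 1) → Bool) → ℝ) :
    cubeAvg g = (cubeAvg (fun x : Fin n → Bool => g (Fin.cons false x)) +
      cubeAvg (fun x : Fin n → Bool => g (Fin.cons true x))) / 2 := by
  have h : ∑ x, g x = ∑ p : Bool × (Fin n → Bool), g (Fin.cons p.1 p.2) :=
    (Fintype.sum_equiv (Fin.consEquiv fun _ => Bool) _ _ fun p => rfl).symm
  rw [cubeAvg, h, Fintype.sum_prod_type]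
  simp only [Fintype.sum_bool, cubeAvg, pow_succ]
  field_simp
  ring

theorem flipBit_involutive {n : ℕ} (i : Fin n) :
    Function.Involutive fun x : Fin n → Bool => flipBit x i := by
  intro x
  simp [flipBit]

theorem flipBit_flipBit {n : ℕ} (x : Fin n → Bool) (i : Fin n) :
    flipBit (flipBit x i) i = x :=
  flipBit_involutive i x

theorem flipBit_cons_zero {n : ℕ} (b : Bool) (x : Fin n → Bool) :
    flipBit (Fin.cons b x : Fin (n + 1) → Bool) 0 = Fin.cons (!b) x := by
  simp [flipBit, Fin.update_cons_zero]

theorem flipBit_cons_succ {n : ℕ} (b : Bool) (x : Fin n → Bool) (i : Fin n) :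
    flipBit (Fin.cons b x : Fin (n + 1) → Bool) i.succ = Fin.cons b (flipBit x i) := by
  simp [flipBit, Fin.cons_update]

theorem cubeAvg_flipBit {n : ℕ} (g : (Fin n → Bool) → ℝ) (i : Fin n) :
    cubeAvg (fun x => g (flipBit x i)) = cubeAvg g := by
  unfold cubeAvg
  rw [Fintype.sum_equiv (flipBit_involutive i).toPerm (fun x => g (flipBit x i)) g fun _ => rfl]

theorem cubeAvg_mul_sq_le {n : ℕ} (g h : (Fin n → Bool) → ℝ) :
    cubeAvg (fun x => g x * h x) ^ 2 ≤
      cubeAvg (fun x => g x ^ 2) * cubeAvg (fun x => h x ^ 2) := by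
  simp only [cubeAvg, div_pow, div_mul_div_comm, ← sq]
  gcongr
  exact Finset.sum_mul_sq_le_sq_mul_sq _ _ _

/-! ### Dirichlet form, influences and variance -/

/-- The Dirichlet form of a function on the binary cube. -/
noncomputable def dirichletForm {n : ℕ} (g : (Fin n → Bool) → ℝ) : ℝ :=
  ∑ i, cubeAvg (fun x => ((g x - g (flipBit x i)) / 2) ^ 2)

/-- The sum of the squared `L¹`-influences of a function on the binary cube. -/
noncomputable def sqInfluence {n : ℕ} (g : (Fin n → Bool) → ℝ) : ℝ :=
  ∑ i, cubeAvg (fun x => |(g x - g (flipBit x i)) / 2|) ^ 2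

/-- The variance of a function on the binary cube under the uniform distribution. -/
noncomputable def cubeVar {n : ℕ} (g : (Fin n → Bool) → ℝ) : ℝ :=
  cubeAvg (fun x => g x ^ 2) - cubeAvg g ^ 2

theorem dirichletForm_succ {n : ℕ} (g : (Fin (n + 1) → Bool) → ℝ) :
    dirichletForm g =
      cubeAvg (fun x : Fin n → Bool => ((g (Fin.cons true x) - g (Fin.cons false x)) / 2) ^ 2) +
      (dirichletForm (fun x : Fin n → Bool => g (Fin.cons false x)) +
        dirichletForm (fun x : Fin n → Bool => g (Fin.cons true x))) / 2 := by
  simp only [dirichletForm, Fin.sum_univ_succ, cubeAvg_succ (n := n), flipBit_cons_zero,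
    flipBit_cons_succ, Bool.not_false, Bool.not_true, ← Finset.sum_div, Finset.sum_add_distrib]
  rw [show (fun x : Fin n → Bool => ((g (Fin.cons false x) - g (Fin.cons true x)) / 2) ^ 2) =
    fun x => ((g (Fin.cons true x) - g (Fin.cons false x)) / 2) ^ 2 by funext x; ring]
  ring

theorem dirichletForm_parallelogram {n : ℕ} (g h : (Fin n → Bool) → ℝ) :
    (dirichletForm g + dirichletForm h) / 2 =
      dirichletForm (fun x => (g x + h x) / 2) + dirichletForm (fun x => (h x - g x) / 2) := by
  simp only [dirichletForm, ← Finset.sum_add_distrib, ← cubeAvg_add]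
  rw [div_eq_inv_mul, Finset.mul_sum]
  refine Finset.sum_congr rfl fun i _ => ?_
  rw [← cubeAvg_const_mul]
  congr 1
  funext x
  ring

/-! ### Entropy and the logarithmic Sobolev inequality -/

/-- The bound `log t ≤ t - 1` at `t = A / M`, `t = B / M`, with `M` the mean, controls the entropy
by `(A - B)² / (4M)`. Then `(√A + √B)² ≤ 4M` finishes. -/
theorem two_point_entropy_le {A B : ℝ} (hA : 0 ≤ A) (hB : 0 ≤ B) :
    (A * Real.log A + B * Real.log B) / 2 - (A + B) / 2 * Real.log ((A + B) / 2) ≤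
      (√A - √B) ^ 2 := by
  rcases (add_nonneg hA hB).eq_or_lt with h | h
  · obtain rfl : A = 0 := by linarith
    obtain rfl : B = 0 := by linarith
    simp
  have hM : 0 < (A + B) / 2 := by linarith
  set M := (A + B) / 2 with hMdef
  have key : ∀ C : ℝ, 0 ≤ C → C * Real.log C ≤ C * Real.log M + C * (C / M - 1) := by
    intro C hC
    rcases hC.eq_or_lt with rfl | hC'
    · simp
    have := Real.log_le_sub_one_of_pos (div_pos hC' hM)
    rw [Real.log_div hC'.ne' hM.ne'] at this
    nlinarith
  have h1 := key A hA
  have h2 := key B hB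
  have ha := Real.sq_sqrt hA
  have hb := Real.sq_sqrt hB
  have h3 : (A * (A / M - 1) + B * (B / M - 1)) / 2 ≤ (√A - √B) ^ 2 := by
    have e : (A * (A / M - 1) + B * (B / M - 1)) / 2 = (A - B) ^ 2 / 4 / M := by
      field_simp
      rw [hMdef]
      ring
    rw [e, div_le_iff₀ hM]
    have e2 : (A - B) ^ 2 = (√A - √B) ^ 2 * (√A + √B) ^ 2 := by
      rw [← mul_pow, ← sub_eq_zero]
      nth_rewrite 1 [← ha]
      nth_rewrite 1 [← hb]
      ring
    have e3 : (√A + √B) ^ 2 ≤ 4 * M := by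
      nlinarith [sq_nonneg (√A - √B)]
    rw [e2]
    nlinarith [mul_le_mul_of_nonneg_left e3 (sq_nonneg (√A - √B))]
  have h4 : M * Real.log M = (A * Real.log M + B * Real.log M) / 2 := by rw [hMdef]; ring
  linarith

/-- Reverse triangle inequality for the `L²` norm. -/
theorem sq_sqrt_sub_sqrt_le {n : ℕ} (g h : (Fin n → Bool) → ℝ) :
    (√(cubeAvg fun x => g x ^ 2) - √(cubeAvg fun x => h x ^ 2)) ^ 2 ≤
      cubeAvg fun x => (h x - g x) ^ 2 := by
  have hg := cubeAvg_nonneg (g := fun x => g x ^ 2) fun x => sq_nonneg _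
  have hh := cubeAvg_nonneg (g := fun x => h x ^ 2) fun x => sq_nonneg _
  have e : (cubeAvg fun x => (h x - g x) ^ 2) = (cubeAvg fun x => g x ^ 2) +
      (cubeAvg fun x => h x ^ 2) - 2 * cubeAvg fun x => g x * h x := by
    rw [← cubeAvg_const_mul, ← cubeAvg_add, ← cubeAvg_sub]
    congr 1
    funext x
    ring
  have cs : (cubeAvg fun x => g x * h x) ≤
      √(cubeAvg fun x => g x ^ 2) * √(cubeAvg fun x => h x ^ 2) := by
    rw [← Real.sqrt_mul hg]
    exact Real.le_sqrt_of_sq_le (cubeAvg_mul_sq_le g h)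
  nlinarith [Real.sq_sqrt hg, Real.sq_sqrt hh]

/-- A logarithmic Sobolev inequality on the binary cube, with twice the optimal constant. -/
theorem entropy_sq_le_dirichletForm {n : ℕ} (g : (Fin n → Bool) → ℝ) :
    cubeAvg (fun x => g x ^ 2 * Real.log (g x ^ 2)) -
      cubeAvg (fun x => g x ^ 2) * Real.log (cubeAvg fun x => g x ^ 2) ≤
        4 * dirichletForm g := by
  induction n with
  | zero => simp [cubeAvg_zero, dirichletForm]
  | succ n ih =>
    have h0 := ih fun x => g (Fin.cons false x)
    have h1 := ih fun x => g (Fin.cons true x)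
    have hd := dirichletForm_succ g
    -- Chain rule: the entropy is the mean of the two conditional entropies plus the two-point
    -- entropy of the conditional second moments.
    have h2 := two_point_entropy_le
      (cubeAvg_nonneg (g := fun x => g (Fin.cons false x) ^ 2) fun x => sq_nonneg _)
      (cubeAvg_nonneg (g := fun x => g (Fin.cons true x) ^ 2) fun x => sq_nonneg _)
    have h3 := sq_sqrt_sub_sqrt_le (fun x => g (Fin.cons false x)) fun x => g (Fin.cons true x)
    have h4 : (cubeAvg fun x : Fin n → Bool =>
        ((g (Fin.cons true x) - g (Fin.cons false x)) / 2) ^ 2) =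
        4⁻¹ * cubeAvg fun x => (g (Fin.cons true x) - g (Fin.cons false x)) ^ 2 := by
      rw [← cubeAvg_const_mul]
      congr 1
      funext x
      ring
    rw [cubeAvg_succ, cubeAvg_succ fun x => g x ^ 2]
    linarith

/-- A function with small `L¹` norm relative to its `L²` norm has large entropy: the best `l` gives
`M log (M / m²)`, where `M` and `m` are the averages of `h²` and `|h|`. Keeping `l` free lets the
bound be summed over coordinates. -/
theorem le_entropy_sq {n : ℕ} (h : (Fin n → Bool) → ℝ) {l : ℝ} (hl : 0 < l) :
    cubeAvg (fun x => h x ^ 2) * (Real.log l + 1) - l * cubeAvg (fun x => |h x|) ^ 2 ≤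
      cubeAvg (fun x => h x ^ 2 * Real.log (h x ^ 2)) -
        cubeAvg (fun x => h x ^ 2) * Real.log (cubeAvg fun x => h x ^ 2) := by
  have hM0 : 0 ≤ cubeAvg fun x => h x ^ 2 := cubeAvg_nonneg fun x => sq_nonneg _
  rcases hM0.eq_or_lt with hM | hM
  · have hz : ∀ x, h x ^ 2 = 0 := by
      intro x
      have h1 : ∑ x, h x ^ 2 = 0 := by
        have := hM.symm
        rw [cubeAvg, div_eq_zero_iff] at this
        exact this.resolve_right (by positivity)
      exact (Finset.sum_eq_zero_iff_of_nonneg fun x _ => sq_nonneg _).1 h1 x (Finset.mem_univ x)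
    have : 0 ≤ l * cubeAvg (fun x => |h x|) ^ 2 := by positivity
    simp only [hz, zero_mul, cubeAvg_const]
    linarith
  set M := cubeAvg fun x => h x ^ 2
  set t := √(l * M) with ht
  have hlM : 0 < l * M := mul_pos hl hM
  have ht0 : 0 < t := Real.sqrt_pos.2 hlM
  have ht2 : t ^ 2 = l * M := Real.sq_sqrt hlM.le
  -- This is `log u ≤ u - 1` at `u = t / |h x|`, multiplied by `2 (h x)²`.
  have pt : ∀ x, (Real.log (t ^ 2) + 2) * h x ^ 2 - 2 * t * |h x| ≤
      h x ^ 2 * Real.log (h x ^ 2) := by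
    intro x
    rcases (abs_nonneg (h x)).eq_or_lt with h0 | h0
    · have : h x = 0 := abs_eq_zero.1 h0.symm
      simp [this]
    rw [← sq_abs (h x)]
    have h1 := Real.log_le_sub_one_of_pos (div_pos ht0 h0)
    rw [Real.log_div ht0.ne' h0.ne'] at h1
    rw [Real.log_pow, Real.log_pow]
    have h2 : |h x| ^ 2 * (t / |h x| - 1) = t * |h x| - |h x| ^ 2 := by
      field_simp
    have h3 := mul_le_mul_of_nonneg_left h1 (sq_nonneg |h x|)
    rw [h2] at h3
    push_cast
    linarith
  have h5 := cubeAvg_mono pt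
  rw [cubeAvg_sub, cubeAvg_const_mul, cubeAvg_const_mul, ht2,
    Real.log_mul hl.ne' hM.ne'] at h5
  change (Real.log l + Real.log M + 2) * M - _ ≤ _ at h5
  set m := cubeAvg fun x => |h x|
  have h6 : l * (2 * t * m) ≤ l * (M + l * m ^ 2) := by
    nlinarith [sq_nonneg (t - l * m)]
  have h7 := le_of_mul_le_mul_left h6 hl
  linarith

/-! ### Variance against influences -/

theorem cubeVar_succ {n : ℕ} (g : (Fin (n + 1) → Bool) → ℝ) :
    cubeVar g =
      cubeVar (fun x : Fin n → Bool => (g (Fin.cons false x) + g (Fin.cons true x)) / 2) +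
      cubeAvg (fun x : Fin n → Bool => ((g (Fin.cons true x) - g (Fin.cons false x)) / 2) ^ 2) := by
  have e : (cubeAvg fun x : Fin n → Bool => (g (Fin.cons false x) + g (Fin.cons true x)) / 2) =
      cubeAvg g := by
    simp only [cubeAvg_succ g, div_eq_inv_mul, cubeAvg_const_mul, cubeAvg_add]
  rw [cubeVar, cubeVar, e, cubeAvg_succ fun x => g x ^ 2, sub_add_eq_add_sub, ← cubeAvg_add,
    ← cubeAvg_add, div_eq_inv_mul, ← cubeAvg_const_mul]
  congr 2
  funext x
  ring

/-- Averaging out the first bit can only shrink the other `L¹`-influences, by the triangle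
inequality. -/
theorem sqInfluence_succ_le {n : ℕ} (g : (Fin (n + 1) → Bool) → ℝ) :
    sqInfluence (fun x : Fin n → Bool => (g (Fin.cons false x) + g (Fin.cons true x)) / 2) +
      cubeAvg (fun x : Fin n → Bool => |(g (Fin.cons true x) - g (Fin.cons false x)) / 2|) ^ 2 ≤
      sqInfluence g := by
  rw [sqInfluence, sqInfluence, Fin.sum_univ_succ, add_comm]
  refine add_le_add (le_of_eq ?_) (Finset.sum_le_sum fun i _ => ?_)
  · congr 1
    rw [cubeAvg_succ]
    simp only [flipBit_cons_zero, Bool.not_false, Bool.not_true]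
    rw [show (fun x : Fin n → Bool => |(g (Fin.cons false x) - g (Fin.cons true x)) / 2|) =
      fun x => |(g (Fin.cons true x) - g (Fin.cons false x)) / 2| by
        funext x
        rw [← abs_neg]
        ring_nf]
    ring
  · refine pow_le_pow_left₀ (cubeAvg_nonneg fun x => abs_nonneg _) ?_ 2
    rw [cubeAvg_succ, ← cubeAvg_add, div_eq_inv_mul, ← cubeAvg_const_mul]
    refine cubeAvg_mono fun x => ?_
    simp only [flipBit_cons_succ]
    refine le_trans (le_of_eq ?_) (mul_le_mul_of_nonneg_left (abs_add_le _ _) (by norm_num))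
    rw [← abs_of_pos (show (0 : ℝ) < 2⁻¹ by norm_num), ← abs_mul]
    congr 1
    ring

/-- A linearised form of the Falik-Samorodnitsky inequality on the binary cube. -/
theorem cubeVar_mul_log_le {n : ℕ} (g : (Fin n → Bool) → ℝ) {l : ℝ} (hl : 0 < l) :
    cubeVar g * (Real.log l + 1) ≤ l * sqInfluence g + 4 * dirichletForm g := by
  induction n with
  | zero => simp [cubeVar, cubeAvg_zero, sqInfluence, dirichletForm]
  | succ n ih =>
    set d : (Fin n → Bool) → ℝ := fun x => (g (Fin.cons true x) - g (Fin.cons false x)) / 2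
      with hd
    have h1 := ih fun x => (g (Fin.cons false x) + g (Fin.cons true x)) / 2
    have h2 := (le_entropy_sq d hl).trans (entropy_sq_le_dirichletForm d)
    have h3 := sqInfluence_succ_le g
    have h4 := dirichletForm_succ g
    -- The energy in the remaining bits splits exactly between the average over the first bit, used
    -- by the induction hypothesis, and `d`, used by the entropy bound.
    rw [dirichletForm_parallelogram] at h4
    have h5 : 0 ≤ cubeAvg fun x => d x ^ 2 := cubeAvg_nonneg fun x => sq_nonneg _
    rw [cubeVar_succ]
    simp only [hd] at h2 h5
    nlinarith [mul_le_mul_of_nonneg_left h3 hl.le]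

/-! ### One-sided drops and localization -/

/-- Each edge of the cube drops from at most one endpoint, and flipping a bit preserves averages, so
one-sided differences carry all the energy. -/
theorem dirichletForm_eq_drops {n : ℕ} (g : (Fin n → Bool) → ℝ) :
    dirichletForm g =
      2⁻¹ * ∑ i, cubeAvg (fun x => max (g x - g (flipBit x i)) 0 ^ 2) := by
  rw [dirichletForm, Finset.mul_sum]
  refine Finset.sum_congr rfl fun i _ => ?_
  have h := cubeAvg_flipBit (fun x => max (g x - g (flipBit x i)) 0 ^ 2) i
  simp only [flipBit_flipBit] at h
  have e : (fun x => ((g x - g (flipBit x i)) / 2) ^ 2) = fun x =>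
      4⁻¹ * (max (g x - g (flipBit x i)) 0 ^ 2 + max (g (flipBit x i) - g x) 0 ^ 2) := by
    funext x
    rcases le_total (g x) (g (flipBit x i)) with hx | hx
    · rw [max_eq_right (sub_nonpos.2 hx), max_eq_left (sub_nonneg.2 hx)]
      ring
    · rw [max_eq_left (sub_nonneg.2 hx), max_eq_right (sub_nonpos.2 hx)]
      ring
  rw [e, cubeAvg_const_mul, cubeAvg_add, h]
  ring

theorem sqInfluence_eq_drops {n : ℕ} (g : (Fin n → Bool) → ℝ) :
    sqInfluence g = ∑ i, cubeAvg (fun x => max (g x - g (flipBit x i)) 0) ^ 2 := by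
  refine Finset.sum_congr rfl fun i _ => ?_
  have h := cubeAvg_flipBit (fun x => max (g x - g (flipBit x i)) 0) i
  simp only [flipBit_flipBit] at h
  have e : (fun x => |(g x - g (flipBit x i)) / 2|) = fun x =>
      2⁻¹ * (max (g x - g (flipBit x i)) 0 + max (g (flipBit x i) - g x) 0) := by
    funext x
    rcases le_total (g x) (g (flipBit x i)) with hx | hx
    · rw [max_eq_right (sub_nonpos.2 hx), max_eq_left (sub_nonneg.2 hx), abs_of_nonpos (by linarith)]
      ring
    · rw [max_eq_left (sub_nonneg.2 hx), max_eq_right (sub_nonpos.2 hx), abs_of_nonneg (by linarith)]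
      ring
  rw [e, cubeAvg_const_mul, cubeAvg_add, h]
  ring

/-- The proportion of points of the binary cube that lie in a set. -/
noncomputable def cubeMass {n : ℕ} (s : Set (Fin n → Bool)) : ℝ :=
  cubeAvg (s.indicator fun _ => 1)

theorem cubeMass_nonneg {n : ℕ} (s : Set (Fin n → Bool)) : 0 ≤ cubeMass s :=
  cubeAvg_nonneg fun _ => Set.indicator_nonneg (fun _ _ => zero_le_one) _

theorem cubeMass_compl {n : ℕ} (s : Set (Fin n → Bool)) : cubeMass sᶜ = 1 - cubeMass s := by
  rw [cubeMass, cubeMass, eq_sub_iff_add_eq, ← cubeAvg_add]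
  refine Eq.trans (congrArg cubeAvg (funext fun x => ?_)) (cubeAvg_const (n := n) 1)
  exact congrFun (Set.indicator_compl_add_self s fun _ => (1 : ℝ)) x

section Localization

variable {n : ℕ} {g : (Fin n → Bool) → ℝ} {s : Set (Fin n → Bool)} {v : ℝ}

theorem sum_cubeAvg_drops_le (hg : BoundedSquaredDrops g v)
    (hs : ∀ x ∉ s, ∀ i, g x ≤ g (flipBit x i)) :
    ∑ i, cubeAvg (fun x => max (g x - g (flipBit x i)) 0 ^ 2) ≤ v * cubeMass s := by
  rw [← cubeAvg_sum, cubeMass, ← cubeAvg_const_mul]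
  refine cubeAvg_mono fun x => ?_
  by_cases hx : x ∈ s
  · simpa [hx] using hg x
  · simp [hx, hs x hx]

theorem dirichletForm_le_mass (hg : BoundedSquaredDrops g v)
    (hs : ∀ x ∉ s, ∀ i, g x ≤ g (flipBit x i)) :
    dirichletForm g ≤ v * cubeMass s / 2 := by
  rw [dirichletForm_eq_drops]
  linarith [sum_cubeAvg_drops_le hg hs]

theorem sqInfluence_le_mass (hg : BoundedSquaredDrops g v)
    (hs : ∀ x ∉ s, ∀ i, g x ≤ g (flipBit x i)) :
    sqInfluence g ≤ v * cubeMass s ^ 2 := by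
  have h : sqInfluence g ≤
      cubeMass s * ∑ i, cubeAvg (fun x => max (g x - g (flipBit x i)) 0 ^ 2) := by
    rw [sqInfluence_eq_drops, Finset.mul_sum]
    refine Finset.sum_le_sum fun i _ => ?_
    -- Cauchy-Schwarz against the indicator of `s`, where all drops live, gains a second factor
    -- `cubeMass s`.
    have cs := cubeAvg_mul_sq_le (s.indicator fun _ => 1)
      fun x => max (g x - g (flipBit x i)) 0
    have e1 : (fun x => s.indicator (fun _ => (1 : ℝ)) x ^ 2) = s.indicator fun _ => 1 := by
      funext x
      by_cases hx : x ∈ s <;> simp [hx]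
    have e2 : (fun x => s.indicator (fun _ => (1 : ℝ)) x * max (g x - g (flipBit x i)) 0) =
        fun x => max (g x - g (flipBit x i)) 0 := by
      funext x
      by_cases hx : x ∈ s
      · simp [hx]
      · simp [hx, hs x hx]
    rwa [e1, e2] at cs
  nlinarith [mul_le_mul_of_nonneg_left (sum_cubeAvg_drops_le hg hs) (cubeMass_nonneg s)]

end Localization

/-! ### Variance of a truncation and the gap inequality -/

theorem cubeVar_eq {n : ℕ} (g : (Fin n → Bool) → ℝ) :
    cubeVar g = cubeAvg fun x => (g x - cubeAvg g) ^ 2 := by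
  have e : (fun x => (g x - cubeAvg g) ^ 2) =
      fun x => g x ^ 2 - (2 * cubeAvg g * g x - cubeAvg g ^ 2) := by
    funext x
    ring
  rw [e, cubeAvg_sub, cubeAvg_sub, cubeAvg_const_mul, cubeAvg_const, cubeVar]
  ring

/-- Keep only `s` and `t`, lower both masses to `δ`, and use `(q - m)² + (r - m)² ≥ (r - q)² / 2`.
-/
theorem le_cubeVar {n : ℕ} {g : (Fin n → Bool) → ℝ} {s t : Set (Fin n → Bool)} {q r δ : ℝ}
    (hqr : q < r) (hs : ∀ x ∈ s, g x = q) (ht : ∀ x ∈ t, g x = r) (hδ : 0 ≤ δ)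
    (hδ2 : δ ≤ 1 / 2) (hsm : 1 / 2 ≤ cubeMass s) (htm : δ ≤ cubeMass t) :
    δ / 2 * (r - q) ^ 2 ≤ cubeVar g := by
  rw [cubeVar_eq]
  set m := cubeAvg g
  have h : (q - m) ^ 2 * cubeMass s + (r - m) ^ 2 * cubeMass t ≤
      cubeAvg fun x => (g x - m) ^ 2 := by
    rw [cubeMass, cubeMass, ← cubeAvg_const_mul, ← cubeAvg_const_mul, ← cubeAvg_add]
    refine cubeAvg_mono fun x => ?_
    by_cases hxs : x ∈ s <;> by_cases hxt : x ∈ t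
    · exact absurd ((hs x hxs).symm.trans (ht x hxt)) hqr.ne
    · simp [hxs, hxt, hs x hxs]
    · simp [hxs, hxt, ht x hxt]
    · simp [hxs, hxt, sq_nonneg]
  have h1 := mul_le_mul_of_nonneg_left hsm (sq_nonneg (q - m))
  have h2 := mul_le_mul_of_nonneg_left htm (sq_nonneg (r - m))
  refine le_trans ?_ (le_trans (add_le_add h1 h2) h)
  linarith [mul_nonneg (sub_nonneg.2 hδ2) (sq_nonneg (q - m)),
    mul_nonneg hδ (sq_nonneg (2 * m - q - r))]

theorem gap_sq_mul_log_le {n : ℕ} {f : (Fin n → Bool) → ℝ} {v : ℝ} (hv : 0 < v)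
    (hf : BoundedSquaredDrops f v) {q r γ δ l : ℝ} (hqr : q < r) (hδ : 0 < δ) (hδγ : δ < γ)
    (hγ : γ ≤ 1 / 2) (hq : 1 - γ ≤ cubeMass {x | f x ≤ q}) (hr : cubeMass {x | f x < r} ≤ 1 - δ)
    (hl : 0 < l) (hl1 : 0 ≤ Real.log l + 1) :
    δ / 2 * (r - q) ^ 2 * (Real.log l + 1) ≤ l * (v * γ ^ 2) + 2 * (v * γ) := by
  set g : (Fin n → Bool) → ℝ := fun x => max q (min (f x) r) with hg
  set s : Set (Fin n → Bool) := {x | f x ≤ q}ᶜ with hsdef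
  have hdrop : ∀ a b : ℝ, max (max q (min a r) - max q (min b r)) 0 ≤ max (a - b) 0 := by
    intro a b
    refine max_le ?_ (le_max_right _ _)
    rcases le_total a b with hab | hab
    · have : max q (min a r) ≤ max q (min b r) := max_le_max le_rfl (min_le_min hab le_rfl)
      exact (sub_nonpos.2 this).trans (le_max_right _ _)
    · refine le_trans ?_ (le_max_left _ _)
      rw [sub_le_iff_le_add]
      refine max_le ?_ ?_
      · linarith [le_max_left q (min b r)]
      · have : min a r ≤ a - b + min b r := by
          rcases le_total b r with hb | hb
          · rw [min_eq_left hb]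
            linarith [min_le_left a r]
          · rw [min_eq_right hb]
            linarith [min_le_right a r]
        linarith [le_max_right q (min b r)]
  have hgv : BoundedSquaredDrops g v := fun x =>
    (Finset.sum_le_sum fun i _ =>
      pow_le_pow_left₀ (le_max_right _ _) (hdrop _ _) 2).trans (hf x)
  have hgs : ∀ x ∉ s, ∀ i, g x ≤ g (flipBit x i) := by
    intro x hx i
    have hx' : f x ≤ q := not_not.1 hx
    have : g x = q := max_eq_left ((min_le_left _ _).trans hx')
    rw [this]
    exact le_max_left _ _
  have hs : cubeMass s ≤ γ := by
    rw [hsdef, cubeMass_compl]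
    linarith
  have hD := dirichletForm_le_mass hgv hgs
  have hT := sqInfluence_le_mass hgv hgs
  have hsq : cubeMass s ^ 2 ≤ γ ^ 2 := pow_le_pow_left₀ (cubeMass_nonneg s) hs 2
  have hV : δ / 2 * (r - q) ^ 2 ≤ cubeVar g := by
    refine le_cubeVar (s := {x | f x ≤ q}) (t := {x | f x < r}ᶜ) hqr
      (fun x hx => max_eq_left ((min_le_left _ _).trans hx)) (fun x hx => ?_) hδ.le
      (by linarith) (by linarith) ?_
    · have hx' : r ≤ f x := not_lt.1 hx
      simp only [hg, min_eq_right hx', max_eq_right hqr.le]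
    · rw [cubeMass_compl]
      linarith
  have h := cubeVar_mul_log_le g hl
  have h1 := mul_le_mul_of_nonneg_right hV hl1
  have h2 := mul_le_mul_of_nonneg_left (hT.trans (mul_le_mul_of_nonneg_left hsq hv.le)) hl.le
  have h3 := mul_le_mul_of_nonneg_left hs hv.le
  linarith

/-! ### Fair bits and quantiles -/

theorem IsFairBits.measureReal_singleton {n : ℕ} {Ω : Type*} [MeasurableSpace Ω] {P : Measure Ω}
    [IsProbabilityMeasure P] {X : Fin n → Ω → Bool} (hX : IsFairBits P X) (x : Fin n → Bool) :
    (P.map fun ω i => X i ω).real {x} = (2 ^ n)⁻¹ := by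
  have hm : Measurable fun ω i => X i ω := measurable_pi_lambda _ hX.measurable
  have h1 : ∀ i b, P.real (X i ⁻¹' {b}) = 2⁻¹ := by
    have ht : ∀ i, P.real (X i ⁻¹' {true}) = 2⁻¹ := fun i =>
      (hX.fair i).trans (one_div 2)
    intro i b
    cases b
    · have e : X i ⁻¹' {false} = (X i ⁻¹' {true})ᶜ := by
        ext ω
        simp
      rw [e, probReal_compl_eq_one_sub (hX.measurable i (measurableSet_singleton _)), ht]
      norm_num
    · exact ht i
  have e : (fun ω i => X i ω) ⁻¹' {x} = ⋂ i ∈ (Finset.univ : Finset (Fin n)), X i ⁻¹' {x i} := by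
    ext ω
    simp [funext_iff]
  rw [map_measureReal_apply hm (measurableSet_singleton _), e, measureReal_def,
    hX.indep.measure_inter_preimage_eq_mul Finset.univ
      (fun i _ => measurableSet_singleton (x i)), ENNReal.toReal_prod]
  simp only [← measureReal_def, h1]
  simp

theorem IsFairBits.measureReal_eq_cubeMass {n : ℕ} {Ω : Type*} [MeasurableSpace Ω]
    {P : Measure Ω} [IsProbabilityMeasure P] {X : Fin n → Ω → Bool} (hX : IsFairBits P X)
    (s : Set (Fin n → Bool)) :
    P.real {ω | (fun i => X i ω) ∈ s} = cubeMass s := by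
  classical
  have hm : Measurable fun ω i => X i ω := measurable_pi_lambda _ hX.measurable
  have h := map_measureReal_apply (μ := P) hm s.toFinite.measurableSet
  rw [Set.preimage] at h
  rw [← h]
  have h2 := sum_measureReal_singleton (μ := P.map fun ω i => X i ω) s.toFinset
  rw [Set.coe_toFinset] at h2
  rw [← h2]
  simp only [hX.measureReal_singleton]
  simp [cubeMass, cubeAvg, Set.indicator_apply, div_eq_mul_inv]

section Quantile

variable {n : ℕ} {Ω : Type*} [MeasurableSpace Ω] {P : Measure Ω} [IsProbabilityMeasure P]
  {X : Fin n → Ω → Bool} {α : ℝ}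

theorem le_cubeMass_quantile (hX : IsFairBits P X) (f : (Fin n → Bool) → ℝ) (hα : α ≤ 1) :
    α ≤ cubeMass {x | f x ≤ quantile P (fun ω => f fun i => X i ω) α} := by
  set q := quantile P (fun ω => f fun i => X i ω) α
  rw [← hX.measureReal_eq_cubeMass]
  by_cases hne : ∃ x, q < f x
  -- `f y` is the least value above `q`: a level `z < f y` from the defining set admits no more
  -- points than `q` does.
  · obtain ⟨y, hy, hmin⟩ := (Finset.univ.filter fun x => q < f x).exists_min_image f
      (hne.imp fun x hx => by simpa using hx)
    simp only [Finset.mem_filter, Finset.mem_univ, true_and] at hy hmin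
    obtain ⟨M, hM⟩ := (Set.finite_range f).bddAbove
    have hS : {z : ℝ | α ≤ P.real {ω | f (fun i => X i ω) ≤ z}}.Nonempty := by
      refine ⟨M, ?_⟩
      have : {ω | f (fun i => X i ω) ≤ M} = Set.univ :=
        Set.eq_univ_of_forall fun ω => hM (Set.mem_range_self _)
      simpa [this] using hα
    obtain ⟨z, hz, hzy⟩ := exists_lt_of_csInf_lt hS hy
    refine le_trans hz (measureReal_mono fun ω hω => ?_)
    by_contra hcon
    exact absurd (hmin _ (not_le.1 hcon)) (not_le.2 (lt_of_le_of_lt hω hzy))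
  · push Not at hne
    have : {ω | (fun i => X i ω) ∈ {x | f x ≤ q}} = Set.univ :=
      Set.eq_univ_of_forall fun ω => hne _
    rwa [this, probReal_univ]

theorem cubeMass_lt_quantile_le (hX : IsFairBits P X) (f : (Fin n → Bool) → ℝ) (hα : 0 < α) :
    cubeMass {x | f x < quantile P (fun ω => f fun i => X i ω) α} ≤ α := by
  set r := quantile P (fun ω => f fun i => X i ω) α
  rw [← hX.measureReal_eq_cubeMass]
  by_cases hne : ∃ x, f x < r
  -- `f y` is the largest value below `r`, so it fails the defining condition, and `f < r` forces `f
  -- ≤ f y`.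
  · obtain ⟨y, hy, hmax⟩ := (Finset.univ.filter fun x => f x < r).exists_max_image f
      (hne.imp fun x hx => by simpa using hx)
    simp only [Finset.mem_filter, Finset.mem_univ, true_and] at hy hmax
    obtain ⟨m, hm⟩ := (Set.finite_range f).bddBelow
    have hS : BddBelow {z : ℝ | α ≤ P.real {ω | f (fun i => X i ω) ≤ z}} := by
      refine ⟨m, fun z hz => ?_⟩
      by_contra hzm
      have : {ω | f (fun i => X i ω) ≤ z} = ∅ := Set.eq_empty_of_forall_notMem fun ω hω =>
        hzm ((hm (Set.mem_range_self _)).trans hω)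
      rw [Set.mem_ofPred_eq, this, measureReal_empty] at hz
      linarith
    have h := notMem_of_lt_csInf hy hS
    refine le_trans (measureReal_mono fun ω hω => ?_) (not_le.1 h).le
    exact hmax _ hω
  · have : {ω | (fun i => X i ω) ∈ {x | f x < r}} = ∅ :=
      Set.eq_empty_of_forall_notMem fun ω hω => hne ⟨_, hω⟩
    rw [this, measureReal_empty]
    exact hα.le

theorem quantile_gap_sq_mul_log_le (hX : IsFairBits P X) {f : (Fin n → Bool) → ℝ} {v : ℝ}
    (hv : 0 < v) (hf : BoundedSquaredDrops f v) {γ δ l : ℝ} (hδ : 0 < δ) (hδγ : δ < γ)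
    (hγ : γ ≤ 1 / 2)
    (hgap : quantile P (fun ω => f fun i => X i ω) (1 - γ) <
      quantile P (fun ω => f fun i => X i ω) (1 - δ))
    (hl : 0 < l) (hl1 : 0 ≤ Real.log l + 1) :
    δ / 2 * (quantile P (fun ω => f fun i => X i ω) (1 - δ) -
        quantile P (fun ω => f fun i => X i ω) (1 - γ)) ^ 2 * (Real.log l + 1) ≤
      l * (v * γ ^ 2) + 2 * (v * γ) :=
  gap_sq_mul_log_le hv hf hgap hδ hδγ hγ (le_cubeMass_quantile hX f (by linarith))
    (cubeMass_lt_quantile_le hX f (by linarith)) hl hl1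

theorem log_exp_two_div {γ : ℝ} (hγ : 0 < γ) :
    Real.log (Real.exp 2 / (2 * γ)) = 2 - Real.log 2 - Real.log γ := by
  rw [Real.log_div (Real.exp_ne_zero _) (by positivity), Real.log_exp,
    Real.log_mul two_ne_zero hγ.ne']
  ring

theorem quantile_gap_le (hX : IsFairBits P X) {f : (Fin n → Bool) → ℝ} {v : ℝ}
    (hv : 0 < v) (hf : BoundedSquaredDrops f v) {γ δ : ℝ} (hδ : 0 < δ) (hδγ : δ < γ)
    (hγ : γ ≤ 1 / 2) :
    quantile P (fun ω => f fun i => X i ω) (1 - δ) -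
        quantile P (fun ω => f fun i => X i ω) (1 - γ) ≤
      √((72 / 5 * v * γ) / (δ * Real.log (Real.exp 2 / (2 * γ)))) := by
  rcases le_or_gt (quantile P (fun ω => f fun i => X i ω) (1 - δ))
    (quantile P (fun ω => f fun i => X i ω) (1 - γ)) with h | h
  · exact (sub_nonpos.2 h).trans (Real.sqrt_nonneg _)
  have hγ0 : 0 < γ := hδ.trans hδγ
  have hlogγ : Real.log γ ≤ -Real.log 2 := by
    rw [← Real.log_inv]
    exact Real.log_le_log hγ0 (by linarith)
  have hlog2 := Real.log_two_gt_d9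
  have hl : Real.log (2 / γ) = Real.log 2 - Real.log γ := Real.log_div two_ne_zero hγ0.ne'
  -- With `l = 2 / γ` both terms on the right equal `2 v γ`, giving the constant `8`, below `72 /
  -- 5`.
  have key := quantile_gap_sq_mul_log_le hX hv hf hδ hδγ hγ h (div_pos two_pos hγ0)
    (by rw [hl]; linarith)
  have e : 2 / γ * (v * γ ^ 2) = 2 * (v * γ) := by
    field_simp
  rw [hl, e] at key
  refine Real.le_sqrt_of_sq_le ?_
  rw [log_exp_two_div hγ0, le_div_iff₀ (mul_pos hδ (by linarith))]
  have h2 : 0 ≤ δ / 2 * (quantile P (fun ω => f fun i => X i ω) (1 - δ) -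
        quantile P (fun ω => f fun i => X i ω) (1 - γ)) ^ 2 := by positivity
  have h3 := mul_le_mul_of_nonneg_left
    (show 2 - Real.log 2 - Real.log γ ≤ Real.log 2 - Real.log γ + 1 by linarith) h2
  have h4 := mul_pos hv hγ0
  linarith

theorem quantile_dyadic_gap_le (hX : IsFairBits P X) {f : (Fin n → Bool) → ℝ} {v : ℝ}
    (hv : 0 < v) (hf : BoundedSquaredDrops f v) {k : ℕ} (hk : 1 ≤ k) :
    quantile P (fun ω => f fun i => X i ω) (1 - ((2 : ℝ) ^ (k + 1))⁻¹) -
        quantile P (fun ω => f fun i => X i ω) (1 - ((2 : ℝ) ^ k)⁻¹) ≤ 4 * √(v / k) := by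
  rcases le_or_gt (quantile P (fun ω => f fun i => X i ω) (1 - ((2 : ℝ) ^ (k + 1))⁻¹))
    (quantile P (fun ω => f fun i => X i ω) (1 - ((2 : ℝ) ^ k)⁻¹)) with h | h
  · exact (sub_nonpos.2 h).trans (by positivity)
  have hk0 : (1 : ℝ) ≤ k := by exact_mod_cast hk
  set γ : ℝ := ((2 : ℝ) ^ k)⁻¹ with hγdef
  have hγ0 : 0 < γ := by positivity
  have hδ : ((2 : ℝ) ^ (k + 1))⁻¹ = γ / 2 := by
    rw [pow_succ, mul_inv, div_eq_mul_inv]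
  have hγ : γ ≤ 1 / 2 := by
    rw [hγdef, one_div]
    exact inv_anti₀ two_pos (le_self_pow₀ one_le_two (by omega))
  have hlogγ : Real.log γ = -(k * Real.log 2) := by
    rw [hγdef, Real.log_inv, Real.log_pow]
  have hlog2 := Real.log_two_gt_d9
  have hlog2' := Real.log_two_lt_d9
  rw [hδ] at h ⊢
  -- A smaller `l` than before: `2 / γ` would give `16 v / ((k + 1) log 2 + 1)`, too weak for large
  -- `k`. Here the bound is `10 v / ((k - 1) log 2 + 1)`.
  have hl : Real.log (1 / (2 * γ)) = k * Real.log 2 - Real.log 2 := by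
    rw [one_div, Real.log_inv, Real.log_mul two_ne_zero hγ0.ne', hlogγ]
    ring
  have hkl := mul_le_mul_of_nonneg_right hk0 (show 0 ≤ Real.log 2 by linarith)
  have key := quantile_gap_sq_mul_log_le hX hv hf (half_pos hγ0) (half_lt_self hγ0) hγ h
    (show 0 < 1 / (2 * γ) by positivity) (by rw [hl]; linarith)
  rw [hl] at key
  set d := quantile P (fun ω => f fun i => X i ω) (1 - γ / 2) -
    quantile P (fun ω => f fun i => X i ω) (1 - γ)
  have e : 1 / (2 * γ) * (v * γ ^ 2) + 2 * (v * γ) = γ * (5 / 2 * v) := by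
    field_simp
    ring
  have h1 : γ * (d ^ 2 * (k * Real.log 2 - Real.log 2 + 1) / 4) ≤ γ * (5 / 2 * v) := by
    linarith
  have h2 := le_of_mul_le_mul_left h1 hγ0
  -- Since `5 / 8 < log 2 < 1`, the denominator is at least `5 k / 8`, and `10 · 8 / 5 = 16 = 4²`.
  have h3 : d ^ 2 * (5 / 8 * k) ≤ d ^ 2 * (k * Real.log 2 - Real.log 2 + 1) := by
    gcongr
    nlinarith
  have h4 : (4 : ℝ) = √(4 ^ 2) := (Real.sqrt_sq (by norm_num)).symm
  rw [h4, ← Real.sqrt_mul (by norm_num)]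
  refine Real.le_sqrt_of_sq_le ?_
  rw [← mul_div_assoc, le_div_iff₀ (by linarith)]
  linarith

end Quantile

theorem theorem2p2 {n : ℕ} {Ω : Type*} [MeasurableSpace Ω] (P : Measure Ω)
    [IsProbabilityMeasure P] (X : Fin n → Ω → Bool) (hX : IsFairBits P X)
    (f : (Fin n → Bool) → ℝ) (v : ℝ) (hv : 0 < v) (hf : BoundedSquaredDrops f v) :
    (∀ γ δ : ℝ, 0 < δ → δ < γ → γ ≤ 1 / 2 →
      quantile P (fun ω => f (fun i => X i ω)) (1 - δ)
          - quantile P (fun ω => f (fun i => X i ω)) (1 - γ)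
        ≤ Real.sqrt ((72 / 5 * v * γ) / (δ * Real.log (Real.exp 2 / (2 * γ))))) ∧
    (∀ a : ℕ → ℝ,
      (∀ k : ℕ, a k = quantile P (fun ω => f (fun i => X i ω)) (1 - ((2 : ℝ) ^ k)⁻¹)) →
      ∀ k : ℕ, 1 ≤ k →
        a (k + 1) - a k
            ≤ 12 / Real.sqrt 5 * Real.sqrt (v / (((k : ℝ) - 1) * Real.log 2 + 2)) ∧
        a (k + 1) - a k ≤ 4 * Real.sqrt (v / (k : ℝ))) := by
  refine ⟨fun γ δ hδ hδγ hγ => quantile_gap_le hX hv hf hδ hδγ hγ, fun a ha k hk => ?_⟩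
  rw [ha, ha]
  refine ⟨?_, quantile_dyadic_gap_le hX hv hf hk⟩
  have hγ0 : 0 < ((2 : ℝ) ^ k)⁻¹ := by positivity
  have hδγ : ((2 : ℝ) ^ (k + 1))⁻¹ < ((2 : ℝ) ^ k)⁻¹ :=
    inv_strictAnti₀ (by positivity) (pow_lt_pow_right₀ one_lt_two k.lt_succ_self)
  have hγ : ((2 : ℝ) ^ k)⁻¹ ≤ 1 / 2 := by
    rw [one_div]
    exact inv_anti₀ two_pos (le_self_pow₀ one_le_two (by omega))
  refine (quantile_gap_le hX hv hf (by positivity) hδγ hγ).trans (le_of_eq ?_)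
  have hk0 : (0 : ℝ) ≤ k - 1 := sub_nonneg.2 (by exact_mod_cast hk)
  have hlog2 : 0 < Real.log 2 := Real.log_pos one_lt_two
  have hL : 0 < ((k : ℝ) - 1) * Real.log 2 + 2 := by positivity
  have e : Real.log (Real.exp 2 / (2 * ((2 : ℝ) ^ k)⁻¹)) = ((k : ℝ) - 1) * Real.log 2 + 2 := by
    rw [log_exp_two_div hγ0, Real.log_inv, Real.log_pow]
    ring
  have h12 : (12 : ℝ) = √(12 ^ 2) := (Real.sqrt_sq (by norm_num)).symm
  rw [e, h12, ← Real.sqrt_div (by norm_num), ← Real.sqrt_mul (by norm_num)]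
  congr 1
  rw [pow_succ]
  field_simp
  norm_num
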